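/- Let $\mathcal M=\langle Q,\mathsf A,\delta\rangle$ be a Markov decision process with a finite set $Q$ of $n$ states, a finite nonempty set $\mathsf A$ of actions and transition function $\delta:Q\times\mathsf A\to\mathcal D(Q)$, let $d_0\in\mathcal D(Q)$ be an initial distribution, and let $T\subseteq Q$. For a (randomized, history-dependent) strategy $\sigma:(Q\mathsf A)^*Q\to\mathcal D(\mathsf A)$, let $\mathcal M^\sigma_i$ be the probability distribution over states after $i$ steps from $d_0$ under $\sigma$, and write $d(T)=\sum_{q\in T}d(q)$. An end-component is a set $S\subseteq Q$ such that (i) for every $q\in S$ the set $\mathsf A_S(q)=\{a\in\mathsf A:\mathrm{Supp}(\delta(q,a))\subseteq S\}$ is nonempty, and (ii) the graph on $S$ with an edge $(q,q')$ whenever $\delta(q,a)(q')>0$ for some $a\in\mathsf A_S(q)$ is strongly connected. Let $\mathcal E$ be the union of all end-components, and for $q\in\mathcal E$ let $\mathcal E(q)$ be the maximal end-component containing $q$. Let $\sigma_{\mathrm u}$ be the strategy that at every round plays all actions uniformly at random. The freezing strategy $\sigma_f$ plays like $\sigma_{\mathrm u}$ for the first $2^n$ rounds; afterwards, in a state $q\in\mathcal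 E$ it plays all actions of $\mathsf A_{\mathcal E(q)}(q)$ uniformly at random, and in a state $q\notin\mathcal E$ it plays all actions uniformly at random. For a strategy $\sigma$, say that $\sigma$ is - positively always synchronizing if $\mathcal M^\sigma_i(T)>0$ for all $i\ge 0$; - boundedly strongly synchronizing if there is $\epsilon>0$ such that $\mathcal M^\sigma_i(T)>\epsilon$ for all but finitely many $i$; - boundedly always synchronizing if there is $\epsilon>0$ such that $\mathcal M^\sigma_i(T)>\epsilon$ for all $i\ge 0$. Consider the conditions (1) $\mathcal M^{\sigma_{\mathrm u}}_i(T)>0$ for all $i\ge 0$; (2) $\mathcal M^{\sigma_{\mathrm u}}_i(\mathcal E\cap T)>0$ for all $i\ge 2^n$. Then: (a) there exists a positively always synchronizing strategy if and only if (1) holds; (b) there exists a boundedly strongly synchronizing strategy if and only if (2) holds; (c) there exists a boundedly always synchronizing strategy if and only if (1) and (2) hold. Moreover, if (2) holds then the freezing strategy $\sigma_f$ is boundedly strongly synchronizing, and if (1) and (2) hold then $\sigma_f$ is boundedly always synchronizing. -/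

import Mathlib

/-- A Markov decision process with state set `Q` and action set `A` (both finite wherever it is
used): `δ q a` is the probability distribution of the successor of `q` under the action `a`. -/
structure MDP (Q A : Type*) [Fintype Q] where
  δ : Q → A → stdSimplex ℝ Q

namespace MDP

section Distributions

/-- The support `{q | d q > 0}` of a distribution. -/
def supp {X : Type*} [Fintype X] (d : stdSimplex ℝ X) : Set X := {x | 0 < d x}

open Classical in
/-- The mass `d(T) = ∑_{x ∈ T} d(x)` of a set `T`. -/
noncomputable def mass {X : Type*} [Fintype X] (d : stdSimplex ℝ X) (T : Set X) : ℝ :=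
  ∑ x with x ∈ T, d x

open Classical in
/-- The uniform distribution on a nonempty set `s`. -/
noncomputable def uniformOn {X : Type*} [Fintype X] (s : Set X) (hs : s.Nonempty) :
    stdSimplex ℝ X :=
  ⟨fun x => if x ∈ s then (s.ncard : ℝ)⁻¹ else 0, by
    refine ⟨fun x => by dsimp only; split_ifs <;> positivity, ?_⟩
    have h0 : (s.ncard : ℝ) ≠ 0 := by
      exact_mod_cast ((Set.ncard_pos s.toFinite).2 hs).ne'
    rw [← Finset.sum_filter, Finset.sum_const, nsmul_eq_mul, Set.ncard_eq_toFinset_card' s,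
      show s.toFinset = Finset.univ.filter (· ∈ s) by ext; simp] at *
    exact mul_inv_cancel₀ h0⟩

end Distributions

section Runs

variable {Q A : Type*} [Fintype Q] [Fintype A]

/-- A randomized strategy. A history `q₀ a₀ q₁ a₁ … q_k` in `(QA)^*Q` is given by its length `k`,
its states `q : Fin (k + 1) → Q` and its actions `a : Fin k → A`. -/
abbrev Strategy (Q A : Type*) [Fintype A] : Type _ :=
  (k : ℕ) → (Fin (k + 1) → Q) → (Fin k → A) → stdSimplex ℝ A

/-- The probability of the finite sequence `q₀ a₀ q₁ … q_k`:
`d₀(q₀) · ∏_{j<k} σ(q₀ a₀ … q_j)(a_j) · δ(q_j, a_j)(q_{j+1})`. -/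
noncomputable def pathProb (M : MDP Q A) (d₀ : stdSimplex ℝ Q) (σ : Strategy Q A) {k : ℕ}
    (q : Fin (k + 1) → Q) (a : Fin k → A) : ℝ :=
  d₀ (q 0) * ∏ j : Fin k,
    σ j (fun m => q (m.castLE (by omega))) (fun m => a (m.castLE (by omega))) (a j) *
      M.δ (q j.castSucc) (a j) (q j.succ)

open Classical in
/-- The probability of being in state `s` after exactly `i` steps: the sum of the probabilities of
the (pairwise disjoint) cylinders of all sequences `q₀ a₀ q₁ … q_i` with `q_i = s`. -/
noncomputable def stepProb (M : MDP Q A) (d₀ : stdSimplex ℝ Q) (σ : Strategy Q A) (i : ℕ)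
    (s : Q) : ℝ :=
  ∑ q : Fin (i + 1) → Q with q (Fin.last i) = s, ∑ a : Fin i → A, M.pathProb d₀ σ q a

theorem pathProb_nonneg (M : MDP Q A) (d₀ : stdSimplex ℝ Q) (σ : Strategy Q A) {k : ℕ}
    (q : Fin (k + 1) → Q) (a : Fin k → A) : 0 ≤ M.pathProb d₀ σ q a :=
  mul_nonneg (d₀.2.1 _) (Finset.prod_nonneg fun _ _ => mul_nonneg ((σ _ _ _).2.1 _)
    ((M.δ _ _).2.1 _))

theorem pathProb_snoc (M : MDP Q A) (d₀ : stdSimplex ℝ Q) (σ : Strategy Q A) {k : ℕ}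
    (q : Fin (k + 1) → Q) (a : Fin k → A) (s : Q) (b : A) :
    M.pathProb d₀ σ (Fin.snoc q s : Fin (k + 1 + 1) → Q) (Fin.snoc a b : Fin (k + 1) → A) =
      M.pathProb d₀ σ q a * (σ k q a b * M.δ (q (Fin.last k)) b s) := by
  have hq : ∀ (i : ℕ) (h : i < k + 1 + 1) (h' : i < k + 1),
      (Fin.snoc q s : Fin (k + 1 + 1) → Q) ⟨i, h⟩ = q ⟨i, h'⟩ := fun i h h' =>
    Fin.snoc_castSucc (α := fun _ => Q) s q ⟨i, h'⟩
  have ha : ∀ (i : ℕ) (h : i < k + 1) (h' : i < k),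
      (Fin.snoc a b : Fin (k + 1) → A) ⟨i, h⟩ = a ⟨i, h'⟩ := fun i h h' =>
    Fin.snoc_castSucc (α := fun _ => A) b a ⟨i, h'⟩
  unfold pathProb
  rw [Fin.prod_univ_castSucc, ← mul_assoc]
  congr 1
  · congr 1
    · refine Finset.prod_congr rfl fun j _ => ?_
      have hj := j.2
      congr 1
      · have e1 : (fun m : Fin (j + 1) => (Fin.snoc q s : Fin (k + 1 + 1) → Q)
            (m.castLE (by omega))) = fun m : Fin (j + 1) => q (m.castLE (by omega)) :=
          funext fun m => hq m _ (by omega)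
        have e2 : (fun m : Fin j => (Fin.snoc a b : Fin (k + 1) → A) (m.castLE (by omega))) =
            fun m : Fin j => a (m.castLE (by omega)) :=
          funext fun m => ha m _ (by omega)
        have e3 := ha j (by omega) hj
        exact congr (congrArg (fun d : stdSimplex ℝ A => (d : A → ℝ))
          (congr (congrArg (σ j) e1) e2)) e3
      · have e1 := hq j (by omega) (by omega)
        have e2 := ha j (by omega) hj
        have e3 := hq (j + 1) (by omega) (by omega)
        exact congr (congrArg (fun d : stdSimplex ℝ Q => (d : Q → ℝ))
          (congr (congrArg M.δ e1) e2)) e3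
  · congr 1
    · have e1 : (fun m : Fin (k + 1) => (Fin.snoc q s : Fin (k + 1 + 1) → Q)
            (m.castLE (by omega))) = q :=
        funext fun m => hq m _ (by omega)
      have e2 : (fun m : Fin k => (Fin.snoc a b : Fin (k + 1) → A) (m.castLE (by omega))) = a :=
        funext fun m => ha m _ (by omega)
      have e3 : (Fin.snoc a b : Fin (k + 1) → A) (Fin.last k) = b := by simp
      exact congr (congrArg (fun d : stdSimplex ℝ A => (d : A → ℝ))
        (congr (congrArg (σ k) e1) e2)) e3
    · simp

theorem sum_pathProb (M : MDP Q A) (d₀ : stdSimplex ℝ Q) (σ : Strategy Q A) (k : ℕ) :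
    ∑ q : Fin (k + 1) → Q, ∑ a : Fin k → A, M.pathProb d₀ σ q a = 1 := by
  induction k with
  | zero =>
    rw [← (Equiv.funUnique (Fin 1) Q).symm.sum_comp]
    simp [pathProb]
  | succ k ih =>
    rw [← ih, ← (Fin.snocEquiv fun _ : Fin (k + 1 + 1) => Q).sum_comp, Fintype.sum_prod_type_right]
    refine Finset.sum_congr rfl fun q _ => ?_
    have h : ∀ s : Q, ∑ a : Fin (k + 1) → A,
        M.pathProb d₀ σ (Fin.snocEquiv (fun _ : Fin (k + 1 + 1) => Q) (s, q)) a =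
        ∑ a : Fin k → A, ∑ b : A,
          M.pathProb d₀ σ q a * (σ k q a b * M.δ (q (Fin.last k)) b s) := fun s => by
      rw [← (Fin.snocEquiv fun _ : Fin (k + 1) => A).sum_comp, Fintype.sum_prod_type_right]
      exact Finset.sum_congr rfl fun a _ => Finset.sum_congr rfl fun b _ =>
        M.pathProb_snoc d₀ σ q a s b
    rw [Finset.sum_congr rfl fun s _ => h s, Finset.sum_comm]
    refine Finset.sum_congr rfl fun a _ => ?_
    rw [Finset.sum_comm]
    simp only [← Finset.mul_sum, stdSimplex.sum_eq_one, mul_one]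

/-- The distribution `M^σ_i` over states after `i` steps under the strategy `σ` from `d₀`. -/
noncomputable def dist (M : MDP Q A) (d₀ : stdSimplex ℝ Q) (σ : Strategy Q A) (i : ℕ) :
    stdSimplex ℝ Q :=
  ⟨M.stepProb d₀ σ i,
    fun _ => Finset.sum_nonneg fun _ _ => Finset.sum_nonneg fun _ _ => M.pathProb_nonneg _ _ _ _,
    by
      classical
      simp only [stepProb]
      rw [← M.sum_pathProb d₀ σ i]
      exact Finset.sum_fiberwise _ (fun q : Fin (i + 1) → Q => q (Fin.last i)) _⟩

end Runs

section EndComponents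

variable {Q A : Type*} [Fintype Q]

/-- `A_S(q)`: the actions that keep all successors of `q` in `S`. -/
def actionsIn (M : MDP Q A) (S : Set Q) (q : Q) : Set A := {a | supp (M.δ q a) ⊆ S}

/-- `S` is closed: from each of its states some action stays in `S`. -/
def IsClosedSet (M : MDP Q A) (S : Set Q) : Prop := ∀ q ∈ S, (M.actionsIn S q).Nonempty

/-- The edge relation `E_S` on `S`. -/
def Edge (M : MDP Q A) (S : Set Q) (q q' : Q) : Prop :=
  q ∈ S ∧ q' ∈ S ∧ ∃ a ∈ M.actionsIn S q, 0 < M.δ q a q'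

/-- `S` is an end-component: it is closed and the graph `(S, E_S)` is strongly connected. -/
def IsEndComponent (M : MDP Q A) (S : Set Q) : Prop :=
  M.IsClosedSet S ∧ ∀ q ∈ S, ∀ q' ∈ S, Relation.ReflTransGen (M.Edge S) q q'

/-- `S` is a maximal end-component: no strict superset is an end-component. -/
def IsMaximalEndComponent (M : MDP Q A) (S : Set Q) : Prop :=
  M.IsEndComponent S ∧ ∀ S', S ⊂ S' → ¬ M.IsEndComponent S'

/-- The union of all (maximal) end-components. -/
def endUnion (M : MDP Q A) : Set Q := ⋃₀ {S | M.IsMaximalEndComponent S}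

/-- The maximal end-component that contains `q`, for `q` in `M.endUnion`
(see `isMaximalEndComponent_maxEndComponent`); it is empty for the other states. -/
def maxEndComponent (M : MDP Q A) (q : Q) : Set Q :=
  ⋃₀ {S | M.IsMaximalEndComponent S ∧ q ∈ S}

theorem actionsIn_mono (M : MDP Q A) {S S' : Set Q} (h : S ⊆ S') (q : Q) :
    M.actionsIn S q ⊆ M.actionsIn S' q := fun _ ha => Set.Subset.trans ha h

theorem IsEndComponent.union {M : MDP Q A} {S S' : Set Q} (h : M.IsEndComponent S)
    (h' : M.IsEndComponent S') {q : Q} (hq : q ∈ S) (hq' : q ∈ S') :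
    M.IsEndComponent (S ∪ S') := by
  have lift : ∀ {R : Set Q}, R ⊆ S ∪ S' → ∀ {x y}, Relation.ReflTransGen (M.Edge R) x y →
      Relation.ReflTransGen (M.Edge (S ∪ S')) x y := fun hR _ _ hxy =>
    Relation.ReflTransGen.mono (fun _ _ ⟨h1, h2, a, ha, hp⟩ =>
      ⟨hR h1, hR h2, a, M.actionsIn_mono hR _ ha, hp⟩) _ _ hxy
  have l := @lift S Set.subset_union_left
  have r := @lift S' Set.subset_union_right
  refine ⟨?_, ?_⟩
  · rintro x (hx | hx)
    · exact (h.1 x hx).mono (M.actionsIn_mono Set.subset_union_left x)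
    · exact (h'.1 x hx).mono (M.actionsIn_mono Set.subset_union_right x)
  · have hto : ∀ x ∈ S ∪ S', Relation.ReflTransGen (M.Edge (S ∪ S')) x q := by
      rintro x (hx | hx)
      · exact l (h.2 x hx q hq)
      · exact r (h'.2 x hx q hq')
    have hfro : ∀ x ∈ S ∪ S', Relation.ReflTransGen (M.Edge (S ∪ S')) q x := by
      rintro x (hx | hx)
      · exact l (h.2 q hq x hx)
      · exact r (h'.2 q hq' x hx)
    exact fun x hx y hy => (hto x hx).trans (hfro y hy)

theorem maxEndComponent_eq {M : MDP Q A} {S : Set Q} (hS : M.IsMaximalEndComponent S) {q : Q}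
    (hq : q ∈ S) : M.maxEndComponent q = S := by
  refine Set.Subset.antisymm (Set.sUnion_subset ?_) (Set.subset_sUnion_of_mem ⟨hS, hq⟩)
  rintro S' ⟨hS', hq'⟩ x hx
  by_contra hxS
  exact hS.2 (S ∪ S') ⟨Set.subset_union_left, fun hsub => hxS (hsub (Or.inr hx))⟩
    (hS.1.union hS'.1 hq hq')

theorem isMaximalEndComponent_maxEndComponent {M : MDP Q A} {q : Q} (hq : q ∈ M.endUnion) :
    M.IsMaximalEndComponent (M.maxEndComponent q) ∧ q ∈ M.maxEndComponent q := by
  obtain ⟨S, hS, hqS⟩ := hq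
  rw [maxEndComponent_eq hS hqS]
  exact ⟨hS, hqS⟩

theorem actionsIn_maxEndComponent_nonempty {M : MDP Q A} {q : Q} (hq : q ∈ M.endUnion) :
    (M.actionsIn (M.maxEndComponent q) q).Nonempty :=
  (isMaximalEndComponent_maxEndComponent hq).1.1.1 q (isMaximalEndComponent_maxEndComponent hq).2

end EndComponents

section Strategies

variable {Q A : Type*} [Fintype Q] [Fintype A]

/-- The strategy `σ_u`: at every round, all actions uniformly at random. -/
noncomputable def uniformStrategy (Q A : Type*) [Fintype A] [Nonempty A] : Strategy Q A :=
  fun _ _ _ => uniformOn Set.univ Set.univ_nonempty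

open Classical in
/-- The strategy that in a state `q` of an end-component plays uniformly at random all actions that
stay in the maximal end-component of `q`, and in the other states plays all actions uniformly at
random. -/
noncomputable def stayStrategy [Nonempty A] (M : MDP Q A) : Strategy Q A :=
  fun k q _ =>
    if h : q (Fin.last k) ∈ M.endUnion then
      uniformOn (M.actionsIn (M.maxEndComponent (q (Fin.last k))) (q (Fin.last k)))
        (actionsIn_maxEndComponent_nonempty h)
    else uniformOn Set.univ Set.univ_nonempty

/-- The freezing strategy: play `σ_u` in the first `2 ^ |Q|` rounds, then switch to
`M.stayStrategy`. -/
noncomputable def freezingStrategy [Nonempty A] (M : MDP Q A) : Strategy Q A :=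
  fun k q a =>
    if k < 2 ^ Fintype.card Q then uniformStrategy Q A k q a else M.stayStrategy k q a

end Strategies

section Synchronization

variable {Q A : Type*} [Fintype Q] [Fintype A]

/-- A sequence of distributions is positively always synchronizing in `T`. -/
def PositivelyAlways (d : ℕ → stdSimplex ℝ Q) (T : Set Q) : Prop :=
  ∀ i, 0 < mass (d i) T

/-- A sequence of distributions is boundedly always synchronizing in `T`. -/
def BoundedlyAlways (d : ℕ → stdSimplex ℝ Q) (T : Set Q) : Prop :=
  ∃ ε : ℝ, 0 < ε ∧ ∀ i, ε < mass (d i) T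

/-- A sequence of distributions is boundedly strongly synchronizing in `T`:
`d_i(T) > ε` for all but finitely many `i`. -/
def BoundedlyStrongly (d : ℕ → stdSimplex ℝ Q) (T : Set Q) : Prop :=
  ∃ ε : ℝ, 0 < ε ∧ ∃ N : ℕ, ∀ i ≥ N, ε < mass (d i) T

/-- The initial distributions that are positive winning for always synchronizing in `T`. -/
def winPositiveAlways (M : MDP Q A) (T : Set Q) : Set (stdSimplex ℝ Q) :=
  {d₀ | ∃ σ : Strategy Q A, PositivelyAlways (M.dist d₀ σ) T}

/-- The initial distributions that are bounded winning for always synchronizing in `T`. -/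
def winBoundedAlways (M : MDP Q A) (T : Set Q) : Set (stdSimplex ℝ Q) :=
  {d₀ | ∃ σ : Strategy Q A, BoundedlyAlways (M.dist d₀ σ) T}

/-- The initial distributions that are bounded winning for strongly synchronizing in `T`. -/
def winBoundedStrongly (M : MDP Q A) (T : Set Q) : Set (stdSimplex ℝ Q) :=
  {d₀ | ∃ σ : Strategy Q A, BoundedlyStrongly (M.dist d₀ σ) T}

/-- Condition (1): under `σ_u`, the mass in `T` is positive at every step. -/
def Condition1 [Nonempty A] (M : MDP Q A) (d₀ : stdSimplex ℝ Q) (T : Set Q) : Prop :=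
  ∀ i : ℕ, 0 < mass (M.dist d₀ (uniformStrategy Q A) i) T

/-- Condition (2): under `σ_u`, the mass in `T` intersected with the union of the end-components is
positive at every step `i ≥ 2 ^ |Q|`. -/
def Condition2 [Nonempty A] (M : MDP Q A) (d₀ : stdSimplex ℝ Q) (T : Set Q) : Prop :=
  ∀ i : ℕ, 2 ^ Fintype.card Q ≤ i →
    0 < mass (M.dist d₀ (uniformStrategy Q A) i) (M.endUnion ∩ T)

end Synchronization

end MDP

/-! Every strategy has its supports inside those of `σ_u`, which proves necessity of (1). The
supports of `σ_u` are the orbit of a deterministic map on the `2 ^ n` subsets of `Q`, hence periodic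
from step `2 ^ n` on.

Necessity of (2): mass at least `ε` outside the end-components cannot persist along an arithmetic
progression of steps. Otherwise Cesàro averages of the state-action distributions would accumulate
at a balanced flow with weight there (`exists_balanced_of_forall_le`), while a balanced flow lives
on end-components (`mem_endUnion_of_balanced`). So at some late step congruent to `i` modulo the
period, a state of `T` in an end-component carries mass; periodicity brings it back to step `i`
under `σ_u`.

Sufficiency: after freezing, every end-component state is recurrent. Going around closed walks shows
that freezing loses none of the end-component states that `σ_u` reaches
(`mem_supp_freezing_of_mem_supp_uniform`), and recurrence bounds their mass below along a
progression (`exists_uniform_lower_bound`). Finitely many residues then give one `ε`. -/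

namespace MDP

/-! ### Supports and masses of finite distributions. -/

section Distributions

variable {X : Type*} [Fintype X]

theorem mass_pos_iff {d : stdSimplex ℝ X} {T : Set X} : 0 < mass d T ↔ ∃ x ∈ T, 0 < d x := by
  classical
  unfold mass
  rw [Finset.sum_pos_iff_of_nonneg fun x _ => stdSimplex.zero_le d x]
  simp

theorem apply_le_mass (d : stdSimplex ℝ X) {T : Set X} {x : X} (hx : x ∈ T) :
    d x ≤ mass d T := by
  classical
  exact Finset.single_le_sum (f := fun x => d x) (fun x _ => stdSimplex.zero_le d x) (by simpa using hx)

theorem mass_eq_sum_indicator (d : stdSimplex ℝ X) (T : Set X) :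
    mass d T = ∑ x, T.indicator d x := by
  classical
  unfold mass
  rw [Finset.sum_filter]
  exact Finset.sum_congr rfl fun x _ => by rw [Set.indicator_apply]

theorem mass_le_mass_inter_add_mass_compl (d : stdSimplex ℝ X) (S T : Set X) :
    mass d T ≤ mass d (S ∩ T) + mass d Sᶜ := by
  simp only [mass_eq_sum_indicator, ← Finset.sum_add_distrib]
  refine Finset.sum_le_sum fun x _ => ?_
  have := stdSimplex.zero_le d x
  by_cases hS : x ∈ S <;> by_cases hT : x ∈ T <;> simp [hS, hT, this]

theorem uniformOn_pos_iff {s : Set X} (hs : s.Nonempty) {x : X} :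
    0 < uniformOn s hs x ↔ x ∈ s := by
  classical
  change 0 < (if x ∈ s then (s.ncard : ℝ)⁻¹ else 0) ↔ x ∈ s
  have h0 : 0 < s.ncard := (Set.ncard_pos s.toFinite).2 hs
  split_ifs with h
  · simp [h, h0]
  · simp [h]

/-- Finitely many positive numbers have a positive lower bound. -/
theorem exists_pos_lower_bound {ι : Type*} [Finite ι] (f : ι → ℝ) :
    ∃ c > 0, ∀ i, 0 < f i → c ≤ f i := by
  classical
  cases nonempty_fintype ι
  by_cases hne : (Finset.univ.filter fun i => 0 < f i).Nonempty
  · obtain ⟨i, hi, hmin⟩ := Finset.exists_min_image _ f hne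
    refine ⟨f i, (Finset.mem_filter.1 hi).2, fun j hj => hmin j (by simpa using hj)⟩
  · refine ⟨1, one_pos, fun i hi => (hne ⟨i, by simpa using hi⟩).elim⟩

end Distributions

/-- An orbit in a finite type is periodic from the cardinality of the type on. -/
theorem exists_period_of_card_le {X : Type*} [Fintype X] (f : ℕ → X) (g : X → X)
    (hf : ∀ i, f (i + 1) = g (f i)) :
    ∃ p > 0, ∀ i ≥ Fintype.card X, ∀ m, f (i + p * m) = f i := by
  obtain ⟨i, j, hij, h⟩ := Fintype.exists_ne_map_eq_of_card_lt
    (fun i : Fin (Fintype.card X + 1) => f i) (by simp)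
  wlog hlt : i < j generalizing i j
  · exact this j i hij.symm h.symm (lt_of_le_of_ne (not_lt.1 hlt) hij.symm)
  have hlt' : (i : ℕ) < j := hlt
  have key : ∀ k, f (j + k) = f (i + k) := by
    intro k
    induction k with
    | zero => exact h.symm
    | succ k ih => rw [← add_assoc, ← add_assoc, hf, hf, ih]
  refine ⟨j - i, by omega, fun k hk m => ?_⟩
  induction m with
  | zero => simp
  | succ m ih =>
    rw [← ih]
    have hi := i.2
    have hj := j.2
    -- Since `i < j ≤ card X ≤ k`, the index is already past the start `i` of the cycle.
    have := key (k + (j - i) * m - i)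
    rw [show (j : ℕ) + (k + (j - i) * m - i) = k + (j - i) * (m + 1) by
      rw [mul_add]; generalize (j - i : ℕ) * m = z; omega] at this
    rw [this]
    congr 1
    generalize (j - i : ℕ) * m = z
    omega

/-! ### One-step evolution and supports under arbitrary and uniform play. -/

section Runs

variable {Q A : Type*} [Fintype Q] [Fintype A]

open Classical in
/-- The probability of being in state `s` after `i` steps and then playing `b`. -/
noncomputable def jointProb (M : MDP Q A) (d₀ : stdSimplex ℝ Q) (σ : Strategy Q A) (i : ℕ)
    (s : Q) (b : A) : ℝ :=
  ∑ q : Fin (i + 1) → Q with q (Fin.last i) = s, ∑ a : Fin i → A,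
    M.pathProb d₀ σ q a * σ i q a b

variable (M : MDP Q A) (d₀ : stdSimplex ℝ Q) (σ : Strategy Q A)

theorem jointProb_nonneg (i : ℕ) (s : Q) (b : A) : 0 ≤ M.jointProb d₀ σ i s b :=
  Finset.sum_nonneg fun _ _ => Finset.sum_nonneg fun _ _ =>
    mul_nonneg (M.pathProb_nonneg _ _ _ _) (stdSimplex.zero_le _ _)

theorem sum_jointProb (i : ℕ) (s : Q) : ∑ b, M.jointProb d₀ σ i s b = M.dist d₀ σ i s := by
  classical
  change _ = M.stepProb d₀ σ i s
  unfold jointProb stepProb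
  rw [Finset.sum_comm]
  refine Finset.sum_congr rfl fun q _ => ?_
  rw [Finset.sum_comm]
  simp only [← Finset.mul_sum, stdSimplex.sum_eq_one, mul_one]

/-- Given the current state and action, the successor does not depend on the earlier history; so the
joint law of state and action suffices even for history-dependent strategies. -/
theorem dist_succ (i : ℕ) (t : Q) :
    M.dist d₀ σ (i + 1) t = ∑ s, ∑ b, M.jointProb d₀ σ i s b * M.δ s b t := by
  classical
  change M.stepProb d₀ σ (i + 1) t = _
  have h1 : ∀ s b, M.jointProb d₀ σ i s b * M.δ s b t =
      ∑ q : Fin (i + 1) → Q with q (Fin.last i) = s, ∑ a : Fin i → A,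
        M.pathProb d₀ σ q a * (σ i q a b * M.δ (q (Fin.last i)) b t) := by
    intro s b
    unfold jointProb
    rw [Finset.sum_mul]
    refine Finset.sum_congr rfl fun q hq => ?_
    rw [Finset.sum_mul, (Finset.mem_filter.1 hq).2]
    exact Finset.sum_congr rfl fun a _ => by ring
  simp only [h1]
  simp_rw [Finset.sum_comm (s := (Finset.univ : Finset A)) (t := Finset.filter _ _)]
  rw [Finset.sum_fiberwise Finset.univ (fun q : Fin (i + 1) → Q => q (Fin.last i))
    (fun q => ∑ b, ∑ a, M.pathProb d₀ σ q a * (σ i q a b * M.δ (q (Fin.last i)) b t))]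
  unfold stepProb
  rw [Finset.sum_filter, ← (Fin.snocEquiv fun _ : Fin (i + 1 + 1) => Q).sum_comp,
    Fintype.sum_prod_type_right]
  refine Finset.sum_congr rfl fun q _ => ?_
  have h2 : ∀ s : Q, ∑ a : Fin (i + 1) → A,
      M.pathProb d₀ σ (Fin.snocEquiv (fun _ : Fin (i + 1 + 1) => Q) (s, q)) a =
      ∑ a : Fin i → A, ∑ b : A,
        M.pathProb d₀ σ q a * (σ i q a b * M.δ (q (Fin.last i)) b s) := fun s => by
    rw [← (Fin.snocEquiv fun _ : Fin (i + 1) => A).sum_comp, Fintype.sum_prod_type_right]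
    exact Finset.sum_congr rfl fun a _ => Finset.sum_congr rfl fun b _ =>
      M.pathProb_snoc d₀ σ q a s b
  simp only [h2]
  rw [Finset.sum_comm (s := (Finset.univ : Finset A))]
  simp [Fin.snocEquiv]

/-- If the action of step `i` is drawn from a distribution that depends on the state only, then
step `i` is a step of a Markov chain. -/
theorem dist_succ_of_memoryless {i : ℕ} {ρ : Q → stdSimplex ℝ A}
    (h : ∀ q a, σ i q a = ρ (q (Fin.last i))) (t : Q) :
    M.dist d₀ σ (i + 1) t = ∑ s, M.dist d₀ σ i s * ∑ b, ρ s b * M.δ s b t := by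
  classical
  rw [dist_succ]
  refine Finset.sum_congr rfl fun s _ => ?_
  have : ∀ b, M.jointProb d₀ σ i s b = M.dist d₀ σ i s * ρ s b := by
    intro b
    change _ = M.stepProb d₀ σ i s * ρ s b
    unfold jointProb stepProb
    rw [Finset.sum_mul]
    refine Finset.sum_congr rfl fun q hq => ?_
    rw [Finset.sum_mul]
    refine Finset.sum_congr rfl fun a _ => ?_
    rw [h, (Finset.mem_filter.1 hq).2]
  simp only [this, Finset.mul_sum, mul_assoc]

/-- The states that some state of `S` reaches in one step with positive probability. -/
def post (S : Set Q) : Set Q := {t | ∃ s ∈ S, ∃ b, 0 < M.δ s b t}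

theorem supp_dist_succ_subset (i : ℕ) :
    supp (M.dist d₀ σ (i + 1)) ⊆ M.post (supp (M.dist d₀ σ i)) := by
  intro t (ht : 0 < M.dist d₀ σ (i + 1) t)
  rw [dist_succ] at ht
  obtain ⟨s, -, hs⟩ := Finset.exists_lt_of_sum_lt (f := fun _ => (0 : ℝ)) (by simpa using ht)
  obtain ⟨b, -, hb⟩ := Finset.exists_lt_of_sum_lt (f := fun _ => (0 : ℝ)) (by simpa using hs)
  have h1 := M.jointProb_nonneg d₀ σ i s b
  refine ⟨s, ?_, b, pos_of_mul_pos_right hb h1⟩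
  change 0 < M.dist d₀ σ i s
  rw [← sum_jointProb]
  exact lt_of_lt_of_le (pos_of_mul_pos_left hb (stdSimplex.zero_le _ _)) (Finset.single_le_sum
    (f := fun b => M.jointProb d₀ σ i s b) (fun b _ => M.jointProb_nonneg d₀ σ i s b)
    (Finset.mem_univ b))

/-- Uniform play gives weight to every action, so no possible successor is missed. Uniformity is
required at step `i` only, which also covers the early rounds of the freezing strategy. -/
theorem supp_dist_succ_of_uniform [Nonempty A] {i : ℕ}
    (h : ∀ q a, σ i q a = uniformStrategy Q A i q a) :
    supp (M.dist d₀ σ (i + 1)) = M.post (supp (M.dist d₀ σ i)) := by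
  refine (M.supp_dist_succ_subset d₀ σ i).antisymm ?_
  rintro t ⟨s, hs, b, hb⟩
  change 0 < M.dist d₀ σ (i + 1) t
  have hs : 0 < M.dist d₀ σ i s := hs
  rw [M.dist_succ_of_memoryless d₀ σ (ρ := fun _ => uniformOn Set.univ Set.univ_nonempty)
    (fun q a => h q a)]
  have h1 : ∀ s, 0 ≤ ∑ b, uniformOn (X := A) Set.univ Set.univ_nonempty b * M.δ s b t :=
    fun s => Finset.sum_nonneg fun b _ => mul_nonneg (stdSimplex.zero_le _ _) (stdSimplex.zero_le _ _)
  refine Finset.sum_pos' (fun s _ => mul_nonneg (stdSimplex.zero_le _ _) (h1 s)) ⟨s, Finset.mem_univ s,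
    mul_pos hs (Finset.sum_pos' (fun b _ => mul_nonneg (stdSimplex.zero_le _ _) (stdSimplex.zero_le _ _))
      ⟨b, Finset.mem_univ b, mul_pos ((uniformOn_pos_iff _).2 (Set.mem_univ b)) hb⟩)⟩

theorem supp_dist_zero : supp (M.dist d₀ σ 0) = supp d₀ := by
  classical
  have h : ∀ s, M.dist d₀ σ 0 s = d₀ s := by
    intro s
    change M.stepProb d₀ σ 0 s = _
    unfold stepProb
    rw [Finset.sum_filter, ← (Equiv.funUnique (Fin 1) Q).symm.sum_comp]
    simp [pathProb]
  ext s
  exact Iff.of_eq (congrArg (0 < ·) (h s))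

theorem supp_dist_subset_uniform [Nonempty A] (i : ℕ) :
    supp (M.dist d₀ σ i) ⊆ supp (M.dist d₀ (uniformStrategy Q A) i) := by
  induction i with
  | zero => rw [supp_dist_zero, supp_dist_zero]
  | succ i ih =>
    rw [M.supp_dist_succ_of_uniform d₀ (uniformStrategy Q A) (i := i) fun _ _ => rfl]
    exact (M.supp_dist_succ_subset d₀ σ i).trans fun _ ⟨s, hs, hb⟩ => ⟨s, ih hs, hb⟩

/-- The bound is inclusive because the state at step `2 ^ n` is determined by the rounds before it.
-/
theorem supp_dist_freezing [Nonempty A] {i : ℕ} (hi : i ≤ 2 ^ Fintype.card Q) :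
    supp (M.dist d₀ M.freezingStrategy i) = supp (M.dist d₀ (uniformStrategy Q A) i) := by
  induction i with
  | zero => rw [supp_dist_zero, supp_dist_zero]
  | succ i ih =>
    rw [M.supp_dist_succ_of_uniform d₀ (uniformStrategy Q A) (i := i) fun _ _ => rfl,
      M.supp_dist_succ_of_uniform d₀ M.freezingStrategy (i := i) fun _ _ => if_pos (by omega),
      ih (by omega)]

theorem exists_period_supp_uniform [Nonempty A] :
    ∃ p > 0, ∀ i ≥ 2 ^ Fintype.card Q, ∀ m,
      supp (M.dist d₀ (uniformStrategy Q A) (i + p * m)) =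
        supp (M.dist d₀ (uniformStrategy Q A) i) := by
  classical
  rw [← Fintype.card_set]
  exact exists_period_of_card_le (fun i => supp (M.dist d₀ (uniformStrategy Q A) i)) M.post
    fun i => M.supp_dist_succ_of_uniform d₀ _ fun _ _ => rfl

end Runs

/-! ### Balanced flows and the mass outside the end-components. -/

section Flows

variable {Q A : Type*} [Fintype Q]

/-- Every end-component is contained in a maximal one. -/
theorem IsEndComponent.subset_endUnion {M : MDP Q A} {S : Set Q} (hS : M.IsEndComponent S) :
    S ⊆ M.endUnion := by
  obtain ⟨S', hSS', hmax⟩ := (Set.toFinite {S | M.IsEndComponent S}).exists_le_maximal hS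
  exact hSS'.trans (Set.subset_sUnion_of_mem
    ⟨hmax.1, fun S'' h h' => h.2 (hmax.2 h' h.1)⟩)

variable [Fintype A]

/-- In a balanced flow `x` on state-action pairs, every state of positive weight belongs to an
end-component. -/
theorem mem_endUnion_of_balanced (M : MDP Q A) {x : Q → A → ℝ} (h0 : ∀ s b, 0 ≤ x s b)
    (hbal : ∀ t, ∑ b, x t b = ∑ s, ∑ b, x s b * M.δ s b t) {q : Q} (hq : 0 < ∑ b, x q b) :
    q ∈ M.endUnion := by
  classical
  set r : Q → Q → Prop := fun s t => ∃ b, 0 < x s b ∧ 0 < M.δ s b t with hr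
  -- no edge enters a set that is closed under the edges
  have hclosed : ∀ R : Set Q, (∀ s ∈ R, ∀ t, r s t → t ∈ R) → ∀ s t, r s t → t ∈ R → s ∈ R := by
    intro R hR s t hst htR
    by_contra hsR
    -- Balance summed over `R`: the weight of `R` equals its inflow. The states of `R` already
    -- return all their weight to `R`, so there is no room for inflow from outside.
    have e1 : ∑ t with t ∈ R, ∑ b, x t b =
        ∑ s, ∑ b, x s b * ∑ t with t ∈ R, M.δ s b t := by
      rw [Finset.sum_congr rfl fun t _ => hbal t, Finset.sum_comm]
      refine Finset.sum_congr rfl fun s _ => ?_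
      rw [Finset.sum_comm]
      exact Finset.sum_congr rfl fun b _ => (Finset.mul_sum _ _ _).symm
    have e2 : ∀ s, s ∈ R → ∑ b, x s b * ∑ t with t ∈ R, M.δ s b t = ∑ b, x s b := by
      intro s hs
      refine Finset.sum_congr rfl fun b _ => ?_
      rcases (h0 s b).eq_or_lt with h | h
      · rw [← h, zero_mul]
      · have : ∑ t with t ∈ R, M.δ s b t = 1 := by
          rw [← stdSimplex.sum_eq_one (M.δ s b), Finset.sum_filter]
          refine Finset.sum_congr rfl fun t _ => ?_
          split_ifs with ht
          · rfl
          · by_contra hne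
            exact ht (hR s hs t ⟨b, h, lt_of_le_of_ne (stdSimplex.zero_le _ _) hne⟩)
        rw [this, mul_one]
    have hnn : ∀ s b, 0 ≤ x s b * ∑ t with t ∈ R, M.δ s b t := fun s b =>
      mul_nonneg (h0 s b) (Finset.sum_nonneg fun t _ => stdSimplex.zero_le _ _)
    rw [← Finset.sum_filter_add_sum_filter_not Finset.univ (· ∈ R) (fun s => ∑ b, x s b *
      ∑ t with t ∈ R, M.δ s b t), Finset.sum_congr rfl fun s hs => e2 s (Finset.mem_filter.1 hs).2]
      at e1
    obtain ⟨b, hb, hd⟩ := hst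
    have hpos : 0 < ∑ s with s ∉ R, ∑ b, x s b * ∑ t with t ∈ R, M.δ s b t :=
      Finset.sum_pos' (fun s _ => Finset.sum_nonneg fun b _ => hnn s b)
        ⟨s, by simpa using hsR, Finset.sum_pos' (fun b _ => hnn s b) ⟨b, Finset.mem_univ b,
          mul_pos hb (Finset.sum_pos' (fun t _ => stdSimplex.zero_le _ _)
            ⟨t, by simpa using htR, hd⟩)⟩⟩
    linarith
  -- The states reachable from `t` form a closed set, so following a path to `t` backwards never
  -- leaves it.
  have hback : ∀ {s t}, Relation.ReflTransGen r s t → Relation.ReflTransGen r t s := by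
    intro s t hst
    have := hclosed {u | Relation.ReflTransGen r t u} fun u hu v huv => hu.tail huv
    induction hst using Relation.ReflTransGen.head_induction_on with
    | refl => exact .refl
    | head h _ ih => exact this _ _ h ih
  -- The end-component sought: the actions carrying flow keep `R` closed, and reversibility of paths
  -- makes it strongly connected.
  set R : Set Q := {t | Relation.ReflTransGen r q t} with hRdef
  have hRpos : ∀ t ∈ R, ∃ b, 0 < x t b := by
    intro t ht
    suffices 0 < ∑ b, x t b by
      obtain ⟨b, -, hb⟩ := Finset.exists_lt_of_sum_lt (f := fun _ => (0 : ℝ)) (by simpa using this)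
      exact ⟨b, hb⟩
    rcases Relation.ReflTransGen.cases_tail ht with rfl | ⟨u, -, b, hb, hd⟩
    · exact hq
    · rw [hbal]
      have hnn : ∀ s b, 0 ≤ x s b * M.δ s b t := fun s b =>
        mul_nonneg (h0 s b) (stdSimplex.zero_le _ _)
      exact Finset.sum_pos' (fun s _ => Finset.sum_nonneg fun b _ => hnn s b)
        ⟨u, Finset.mem_univ u, Finset.sum_pos' (fun b _ => hnn u b)
          ⟨b, Finset.mem_univ b, mul_pos hb hd⟩⟩
  have hact : ∀ s ∈ R, ∀ b, 0 < x s b → b ∈ M.actionsIn R s := fun s hs b hb t ht =>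
    Relation.ReflTransGen.tail hs ⟨b, hb, ht⟩
  have hEdge : ∀ {s t}, s ∈ R → Relation.ReflTransGen r s t →
      Relation.ReflTransGen (M.Edge R) s t := by
    intro s t hs hst
    induction hst with
    | refl => exact .refl
    | tail h1 h2 ih =>
      have hmem := Relation.ReflTransGen.trans hs h1
      exact ih.tail ⟨hmem, hmem.tail h2, h2.imp fun b hb => ⟨hact _ hmem b hb.1, hb.2⟩⟩
  have hR : M.IsEndComponent R := by
    refine ⟨fun s hs => (hRpos s hs).imp fun b hb => hact s hs b hb, fun s hs t ht => ?_⟩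
    exact hEdge hs ((hback hs).trans ht)
  exact hR.subset_endUnion (Relation.ReflTransGen.refl)

open Filter Topology in
/-- The Cesàro averages of a sequence of flows that is carried along by the transition function
accumulate at a balanced flow. -/
theorem exists_balanced_of_forall_le (M : MDP Q A) {y : ℕ → Q × A → ℝ}
    (hy : ∀ i, y i ∈ stdSimplex ℝ (Q × A))
    (hstep : ∀ i t, ∑ b, y (i + 1) (t, b) = ∑ s, ∑ b, y i (s, b) * M.δ s b t)
    {p : ℕ} (hp : 0 < p) {w : Q × A → ℝ} (hw : ∀ z, 0 ≤ w z) {ε : ℝ}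
    (hε : ∀ m, ε ≤ ∑ z, w z * y (p * m) z) :
    ∃ x : Q × A → ℝ, (∀ z, 0 ≤ x z) ∧
      (∀ t, ∑ b, x (t, b) = ∑ s, ∑ b, x (s, b) * M.δ s b t) ∧ ε / p ≤ ∑ z, w z * x z := by
  classical
  -- Averaging over whole blocks of `p` steps: each block contains one multiple of `p`, which
  -- contributes at least `ε`, whence the bound `ε / p`.
  set n : ℕ → ℝ := fun k => ((p * (k + 1) : ℕ) : ℝ) with hn
  have hn0 : ∀ k, 0 < n k := fun k => by simp only [hn]; exact_mod_cast Nat.mul_pos hp k.succ_pos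
  set u : ℕ → Q × A → ℝ := fun k z => (n k)⁻¹ * ∑ i ∈ Finset.range (p * (k + 1)), y i z with hu
  have hu1 : ∀ k, u k ∈ stdSimplex ℝ (Q × A) := by
    refine fun k => ⟨fun z => mul_nonneg (inv_nonneg.2 (hn0 k).le)
      (Finset.sum_nonneg fun i _ => (hy i).1 z), ?_⟩
    simp only [hu]
    rw [← Finset.mul_sum, Finset.sum_comm, Finset.sum_congr rfl fun i _ => (hy i).2]
    simpa [hn] using inv_mul_cancel₀ (hn0 k).ne'
  have hmass : ∀ k, ε / p ≤ ∑ z, w z * u k z := by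
    intro k
    have h1 : ∀ k : ℕ, (k : ℝ) * ε ≤ ∑ i ∈ Finset.range (p * k), ∑ z, w z * y i z := by
      intro k
      induction k with
      | zero => simp
      | succ k ih =>
        rw [mul_add, mul_one, Finset.sum_range_add]
        have h2 := Finset.single_le_sum (f := fun j => ∑ z, w z * y (p * k + j) z)
          (fun j _ => Finset.sum_nonneg fun z _ => mul_nonneg (hw z) ((hy _).1 z))
          (Finset.mem_range.2 hp)
        have h3 := hε k
        simp only [add_zero] at h2
        push_cast
        linarith
    have h2 : ∑ z, w z * u k z =
        (n k)⁻¹ * ∑ i ∈ Finset.range (p * (k + 1)), ∑ z, w z * y i z := by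
      simp only [hu]
      rw [Finset.sum_comm, Finset.mul_sum]
      refine Finset.sum_congr rfl fun z _ => ?_
      rw [← Finset.mul_sum]
      ring
    rw [h2, inv_mul_eq_div, le_div_iff₀ (hn0 k)]
    refine le_trans (le_of_eq ?_) (h1 (k + 1))
    have : (p : ℝ) ≠ 0 := by exact_mod_cast hp.ne'
    simp only [hn]
    push_cast
    field_simp
  -- Transporting the average shifts its window by one step, so the difference telescopes to its two
  -- end terms.
  have hdefect : ∀ k t, |∑ b, u k (t, b) - ∑ s, ∑ b, u k (s, b) * M.δ s b t| ≤ (n k)⁻¹ := by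
    intro k t
    have e : ∑ b, u k (t, b) - ∑ s, ∑ b, u k (s, b) * M.δ s b t =
        (n k)⁻¹ * (∑ b, y 0 (t, b) - ∑ b, y (p * (k + 1)) (t, b)) := by
      have e1 : ∑ b, u k (t, b) =
          (n k)⁻¹ * ∑ i ∈ Finset.range (p * (k + 1)), ∑ b, y i (t, b) := by
        simp only [hu]
        rw [← Finset.mul_sum, Finset.sum_comm]
      have e2 : ∑ s, ∑ b, u k (s, b) * M.δ s b t =
          (n k)⁻¹ * ∑ i ∈ Finset.range (p * (k + 1)), ∑ b, y (i + 1) (t, b) := by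
        simp only [hstep, hu]
        rw [Finset.sum_comm (s := Finset.range _), Finset.mul_sum]
        refine Finset.sum_congr rfl fun s _ => ?_
        rw [Finset.sum_comm (s := Finset.range _), Finset.mul_sum]
        refine Finset.sum_congr rfl fun b _ => ?_
        rw [← Finset.sum_mul]
        ring
      rw [e1, e2, ← mul_sub, ← Finset.sum_sub_distrib,
        Finset.sum_range_sub' (fun i => ∑ b, y i (t, b))]
    have hb : ∀ i, 0 ≤ ∑ b, y i (t, b) ∧ ∑ b, y i (t, b) ≤ 1 := by
      refine fun i => ⟨Finset.sum_nonneg fun b _ => (hy i).1 _, ?_⟩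
      rw [← (hy i).2, Fintype.sum_prod_type]
      exact Finset.single_le_sum (f := fun s => ∑ b, y i (s, b))
        (fun s _ => Finset.sum_nonneg fun b _ => (hy i).1 _) (Finset.mem_univ t)
    rw [e, abs_mul, abs_of_pos (inv_pos.2 (hn0 k))]
    refine mul_le_of_le_one_right (inv_pos.2 (hn0 k)).le (abs_le.2 ?_)
    have := hb 0
    have := hb (p * (k + 1))
    constructor <;> linarith
  obtain ⟨x, hx, φ, hφ, hlim⟩ := (isCompact_stdSimplex ℝ (Q × A)).tendsto_subseq hu1
  have hlim' : ∀ z, Tendsto (fun k => u (φ k) z) atTop (𝓝 (x z)) := fun z =>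
    (tendsto_pi_nhds.1 hlim) z
  have hninv : Tendsto (fun k => (n (φ k))⁻¹) atTop (𝓝 0) := by
    refine tendsto_inv_atTop_zero.comp (tendsto_natCast_atTop_atTop.comp ?_)
    refine tendsto_atTop_mono (fun k => ?_) (tendsto_id (α := ℕ))
    have := hφ.id_le k
    simp only [id] at this ⊢
    nlinarith
  refine ⟨x, hx.1, fun t => ?_, ?_⟩
  · have hd : Tendsto (fun k => ∑ b, u (φ k) (t, b) - ∑ s, ∑ b, u (φ k) (s, b) * M.δ s b t) atTop
        (𝓝 (∑ b, x (t, b) - ∑ s, ∑ b, x (s, b) * M.δ s b t)) :=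
      (tendsto_finsetSum _ fun b _ => hlim' _).sub (tendsto_finsetSum _ fun s _ =>
        tendsto_finsetSum _ fun b _ => (hlim' _).mul_const _)
    exact sub_eq_zero.1 (tendsto_nhds_unique hd
      (squeeze_zero_norm (fun k => hdefect (φ k) t) hninv))
  · exact ge_of_tendsto' (tendsto_finsetSum _ fun z _ => (hlim' z).const_mul _)
      fun k => hmass (φ k)

/-- Along every arithmetic progression of steps, the mass outside of the end-components gets
arbitrarily small, under every strategy. -/
theorem exists_mass_compl_endUnion_lt (M : MDP Q A) (d₀ : stdSimplex ℝ Q) (σ : Strategy Q A)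
    (k : ℕ) {p : ℕ} (hp : 0 < p) {ε : ℝ} (hε : 0 < ε) :
    ∃ m, mass (M.dist d₀ σ (k + p * m)) M.endUnionᶜ < ε := by
  classical
  -- The flow obtained from the joint laws would have weight at least `ε / p` outside the
  -- end-components.
  by_contra! hcon
  obtain ⟨x, h0, hbal, hx⟩ := M.exists_balanced_of_forall_le
    (y := fun i z => M.jointProb d₀ σ (k + i) z.1 z.2)
    (fun i => ⟨fun z => M.jointProb_nonneg _ _ _ _ _, by
      rw [Fintype.sum_prod_type]
      simp only [sum_jointProb, stdSimplex.sum_eq_one]⟩)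
    (fun i t => by simp only [sum_jointProb]; exact M.dist_succ d₀ σ (k + i) t) hp
    (w := fun z => M.endUnionᶜ.indicator 1 z.1)
    (fun z => Set.indicator_nonneg (fun _ _ => zero_le_one) _) (ε := ε) (fun m => by
      refine (hcon m).trans (le_of_eq ?_)
      rw [mass_eq_sum_indicator, Fintype.sum_prod_type]
      refine Finset.sum_congr rfl fun s _ => ?_
      dsimp only
      rw [← Finset.mul_sum, sum_jointProb]
      by_cases hs : s ∈ M.endUnion <;> simp [hs])
  have hpos : 0 < ε / p := div_pos hε (by exact_mod_cast hp)
  have hzero : ∑ z : Q × A, M.endUnionᶜ.indicator 1 z.1 * x z ≤ 0 := by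
    rw [Fintype.sum_prod_type]
    refine Finset.sum_nonpos fun s _ => ?_
    dsimp only
    rw [← Finset.mul_sum]
    by_cases hs : s ∈ M.endUnion
    · simp [hs]
    · have : ∑ b, x (s, b) ≤ 0 := not_lt.1 fun h =>
        hs (M.mem_endUnion_of_balanced (x := fun s b => x (s, b)) (fun s b => h0 _) hbal h)
      simpa [hs] using this
  linarith

end Flows

open Matrix

/-! ### Powers of stochastic matrices and recurrence. -/

section RecurrentStates

variable {Q : Type*} [Fintype Q] [DecidableEq Q] {P : Matrix Q Q ℝ}

/-- Nonnegative entries cannot cancel, so positivity of an entry of `P ^ k` means that there is a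
walk of length `k`, and walks can be split and concatenated. -/
theorem pow_add_apply_pos_iff (hP : P ∈ rowStochastic ℝ Q) (k l : ℕ) (s t : Q) :
    0 < (P ^ (k + l)) s t ↔ ∃ u, 0 < (P ^ k) s u ∧ 0 < (P ^ l) u t := by
  have h : ∀ k s t, 0 ≤ (P ^ k) s t := fun k s t => (pow_mem hP k).1 s t
  rw [pow_add, Matrix.mul_apply,
    Finset.sum_pos_iff_of_nonneg fun u _ => mul_nonneg (h k s u) (h l u t)]
  simp only [Finset.mem_univ, true_and]
  exact exists_congr fun u => ⟨fun hu => ⟨pos_of_mul_pos_left hu (h _ _ _),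
    pos_of_mul_pos_right hu (h _ _ _)⟩, fun hu => mul_pos hu.1 hu.2⟩

theorem exists_pow_apply_pos (hP : P ∈ rowStochastic ℝ Q) (k : ℕ) (s : Q) :
    ∃ t, 0 < (P ^ k) s t := by
  by_contra! h
  have h1 := sum_row_of_mem_rowStochastic (pow_mem hP k) s
  have h2 : ∑ t, (P ^ k) s t ≤ 0 := Finset.sum_nonpos fun t _ => h t
  linarith

theorem pow_mul_apply_self_pos (hP : P ∈ rowStochastic ℝ Q) {k : ℕ} {s : Q}
    (h : 0 < (P ^ k) s s) (m : ℕ) : 0 < (P ^ (k * m)) s s := by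
  induction m with
  | zero => simp
  | succ m ih =>
    rw [mul_add, mul_one, pow_add_apply_pos_iff hP]
    exact ⟨s, ih, h⟩

/-- The zero pattern of some power of a stochastic matrix is idempotent. -/
theorem exists_pow_mul_apply_pos_iff (hP : P ∈ rowStochastic ℝ Q) :
    ∃ k > 0, ∀ m > 0, ∀ s t, 0 < (P ^ (k * m)) s t ↔ 0 < (P ^ k) s t := by
  obtain ⟨p, hp, h⟩ := exists_period_of_card_le (X := Set (Q × Q))
    (fun k => {z | 0 < (P ^ k) z.1 z.2})
    (fun B => {z | ∃ u, (z.1, u) ∈ B ∧ 0 < P u z.2}) (fun k => by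
      ext ⟨s, t⟩
      simpa using pow_add_apply_pos_iff hP k 1 s t)
  have hc : 0 < Fintype.card (Set (Q × Q)) := Fintype.card_pos
  generalize Fintype.card (Set (Q × Q)) = c at h hc
  -- A multiple of the period `p` beyond the threshold `c`; its positive multiples differ from it by
  -- multiples of `p`.
  refine ⟨p * c, Nat.mul_pos hp hc, fun m hm s t => ?_⟩
  obtain ⟨m, rfl⟩ := Nat.exists_eq_succ_of_ne_zero hm.ne'
  have := h (p * c) (Nat.le_mul_of_pos_left c hp) (c * m)
  rw [show p * c + p * (c * m) = p * c * m.succ by rw [Nat.succ_eq_add_one]; ring] at this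
  exact Set.ext_iff.1 this (s, t)

/-- Let `D` be the distributions of a finite Markov chain whose edges out of states of `E` can be travelled back. A state
of `E` that carries mass at step `r` does so, with a uniform bound, at all steps `r + k m`. -/
theorem exists_uniform_lower_bound (hP : P ∈ rowStochastic ℝ Q) {E : Set Q}
    (hE : ∀ s ∈ E, ∀ t, 0 < P s t → t ∈ E ∧ ∃ l, 0 < (P ^ l) t s) {k : ℕ} (hk : 0 < k)
    (hidem : ∀ m > 0, ∀ s t, 0 < (P ^ (k * m)) s t ↔ 0 < (P ^ k) s t)
    {D : ℕ → Q → ℝ} (h0 : ∀ i s, 0 ≤ D i s) (hD : ∀ i, D (i + 1) = D i ᵥ* P) {q : Q} (hq : q ∈ E)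
    {r : ℕ} (hr : 0 < D r q) : ∃ c > 0, ∀ m, c ≤ D (r + k * m) q := by
  classical
  have hback : ∀ j s, s ∈ E → ∀ t, 0 < (P ^ j) s t → t ∈ E ∧ ∃ l, 0 < (P ^ l) t s := by
    intro j
    induction j with
    | zero =>
      intro s hs t ht
      have : s = t := by
        by_contra hne
        simp [hne] at ht
      subst this
      exact ⟨hs, 0, by simp⟩
    | succ j ih =>
      intro s hs t ht
      obtain ⟨u, hu, hut⟩ := (pow_add_apply_pos_iff hP j 1 s t).1 ht
      obtain ⟨huE, l, hl⟩ := ih s hs u hu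
      obtain ⟨htE, l', hl'⟩ := hE u huE t (by simpa using hut)
      exact ⟨htE, l' + l, (pow_add_apply_pos_iff hP _ _ _ _).2 ⟨u, hl', hl⟩⟩
  -- A closed walk repeated `k` times has length divisible by `k`, and idempotence shortens it to
  -- length `k`.
  have hrefl : ∀ s ∈ E, 0 < (P ^ k) s s := by
    intro s hs
    obtain ⟨t, ht⟩ := exists_pow_apply_pos hP 1 s
    obtain ⟨-, l, hl⟩ := hback 1 s hs t ht
    have h1 := pow_mul_apply_self_pos hP ((pow_add_apply_pos_iff hP _ _ _ _).2 ⟨t, ht, hl⟩) k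
    rw [mul_comm] at h1
    exact (hidem (1 + l) (by omega) s s).1 h1
  have hsymm : ∀ s ∈ E, ∀ t, 0 < (P ^ k) s t → 0 < (P ^ k) t s := by
    intro s hs t ht
    obtain ⟨htE, l, hl⟩ := hback k s hs t ht
    -- Going `2k - 1` times around the closed walk of length `l + k` and then back to `s` takes `(l
    -- + k)(2k - 1) + l = k(2l + 2k - 1)` steps, a multiple of `k`.
    have h1 := pow_mul_apply_self_pos hP ((pow_add_apply_pos_iff hP _ _ _ _).2 ⟨s, hl, ht⟩)
      (2 * k - 1)
    have h2 := (pow_add_apply_pos_iff hP _ _ _ _).2 ⟨t, h1, hl⟩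
    obtain ⟨k, rfl⟩ := Nat.exists_eq_succ_of_ne_zero hk.ne'
    refine (hidem (2 * l + 2 * k + 1) (by omega) t s).1 ?_
    convert h2 using 3
    rw [show 2 * k.succ - 1 = 2 * k + 1 by omega, Nat.succ_eq_add_one]
    ring
  have htrans : ∀ s t u, 0 < (P ^ k) s t → 0 < (P ^ k) t u → 0 < (P ^ k) s u := by
    intro s t u hst htu
    rw [← hidem 2 two_pos, mul_two]
    exact (pow_add_apply_pos_iff hP _ _ _ _).2 ⟨t, hst, htu⟩
  have hDk : ∀ i j, D (i + j) = D i ᵥ* P ^ j := by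
    intro i j
    induction j with
    | zero => simp
    | succ j ih => rw [← add_assoc, hD, ih, pow_succ, Matrix.vecMul_vecMul]
  set C : Finset Q := Finset.univ.filter fun s => 0 < (P ^ k) q s with hC
  have hmem : ∀ s, s ∈ C ↔ 0 < (P ^ k) q s := fun s => by simp [hC]
  have hqC : q ∈ C := (hmem q).2 (hrefl q hq)
  -- no mass leaves the class of `q`
  have hmass : ∀ i, ∑ s ∈ C, D i s ≤ ∑ s ∈ C, D (i + k) s := by
    intro i
    have h1 : ∀ s ∈ C, ∑ t ∈ C, (P ^ k) s t = 1 := by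
      intro s hs
      rw [← sum_row_of_mem_rowStochastic (pow_mem hP k) s, hC, Finset.sum_filter]
      refine Finset.sum_congr rfl fun t _ => ?_
      split_ifs with ht
      · rfl
      · by_contra hne
        exact ht (htrans _ _ _ ((hmem s).1 hs)
          (lt_of_le_of_ne ((pow_mem hP k).1 s t) hne))
    calc ∑ s ∈ C, D i s = ∑ s ∈ C, D i s * ∑ t ∈ C, (P ^ k) s t :=
          Finset.sum_congr rfl fun s hs => by rw [h1 s hs, mul_one]
      _ = ∑ t ∈ C, ∑ s ∈ C, D i s * (P ^ k) s t := by
          simp only [Finset.mul_sum]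
          exact Finset.sum_comm
      _ ≤ ∑ t ∈ C, D (i + k) t := by
          refine Finset.sum_le_sum fun t _ => ?_
          rw [hDk]
          exact Finset.sum_le_univ_sum_of_nonneg fun s => mul_nonneg (h0 i s) ((pow_mem hP k).1 s t)
  have hmass' : ∀ m, D r q ≤ ∑ s ∈ C, D (r + k * m) s := by
    intro m
    induction m with
    | zero => exact Finset.single_le_sum (f := D r) (fun s _ => h0 r s) hqC
    | succ m ih =>
      rw [mul_add, mul_one, ← add_assoc]
      exact ih.trans (hmass _)
  -- Within `k` steps every state of the class passes at least the fraction `η` of its mass to `q`.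
  -- The minimum below accounts for `m = 0`, where no such step has been made.
  obtain ⟨η, hη, hle⟩ := exists_pos_lower_bound fun s => (P ^ k) s q
  refine ⟨min (D r q) (D r q * η), lt_min hr (mul_pos hr hη), fun m => ?_⟩
  rcases m with _ | m
  · exact min_le_left _ _
  · refine (min_le_right _ _).trans ?_
    rw [mul_add, mul_one, ← add_assoc, hDk]
    calc D r q * η ≤ (∑ s ∈ C, D (r + k * m) s) * η :=
          mul_le_mul_of_nonneg_right (hmass' m) hη.le
      _ = ∑ s ∈ C, D (r + k * m) s * η := Finset.sum_mul _ _ _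
      _ ≤ ∑ s ∈ C, D (r + k * m) s * (P ^ k) s q := Finset.sum_le_sum fun s hs =>
          mul_le_mul_of_nonneg_left (hle s (hsymm q hq s ((hmem s).1 hs))) (h0 _ s)
      _ ≤ _ := Finset.sum_le_univ_sum_of_nonneg fun s =>
          mul_nonneg (h0 _ s) ((pow_mem hP k).1 s q)

end RecurrentStates

/-! ### The Markov chain after freezing. -/

section Freezing

variable {Q A : Type*} [Fintype Q] [Fintype A] [Nonempty A] (M : MDP Q A)

open Classical in
/-- The action distribution of `M.stayStrategy` in the state `s`. -/
noncomputable def stayDist (s : Q) : stdSimplex ℝ A :=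
  if h : s ∈ M.endUnion then
    uniformOn (M.actionsIn (M.maxEndComponent s) s) (actionsIn_maxEndComponent_nonempty h)
  else uniformOn Set.univ Set.univ_nonempty

/-- The transition matrix of the Markov chain that `M.stayStrategy` induces. -/
noncomputable def stayMatrix : Matrix Q Q ℝ := fun s t => ∑ b, M.stayDist s b * M.δ s b t

theorem stayMatrix_mem_rowStochastic [DecidableEq Q] : M.stayMatrix ∈ rowStochastic ℝ Q := by
  refine mem_rowStochastic_iff_sum.2 ⟨fun s t => Finset.sum_nonneg fun b _ =>
    mul_nonneg (stdSimplex.zero_le _ _) (stdSimplex.zero_le _ _), fun s => ?_⟩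
  unfold stayMatrix
  rw [Finset.sum_comm]
  simp only [← Finset.mul_sum, stdSimplex.sum_eq_one, mul_one]

theorem stayMatrix_pos_iff {s t : Q} :
    0 < M.stayMatrix s t ↔ ∃ b, 0 < M.stayDist s b ∧ 0 < M.δ s b t := by
  unfold stayMatrix
  rw [Finset.sum_pos_iff_of_nonneg fun b _ =>
    mul_nonneg (stdSimplex.zero_le _ _) (stdSimplex.zero_le _ _)]
  simp only [Finset.mem_univ, true_and]
  exact exists_congr fun b => ⟨fun h => ⟨pos_of_mul_pos_left h (stdSimplex.zero_le _ _),
    pos_of_mul_pos_right h (stdSimplex.zero_le _ _)⟩, fun h => mul_pos h.1 h.2⟩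

theorem stayMatrix_pos_iff_edge {S : Set Q} (hS : M.IsMaximalEndComponent S) {s t : Q}
    (hs : s ∈ S) : 0 < M.stayMatrix s t ↔ M.Edge S s t := by
  have hsE : s ∈ M.endUnion := ⟨S, hS, hs⟩
  have h : ∀ b, 0 < M.stayDist s b ↔ b ∈ M.actionsIn S s := fun b => by
    unfold stayDist
    rw [dif_pos hsE, uniformOn_pos_iff, maxEndComponent_eq hS hs]
  rw [stayMatrix_pos_iff]
  simp only [h]
  exact ⟨fun ⟨b, hb, hd⟩ => ⟨hs, hb hd, b, hb, hd⟩, fun h => h.2.2⟩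

/-- Inside a maximal end-component the chain has exactly the edges of its strongly connected graph,
so a return walk exists. -/
theorem stayMatrix_recurrent [DecidableEq Q] {s t : Q} (hs : s ∈ M.endUnion)
    (hst : 0 < M.stayMatrix s t) : t ∈ M.endUnion ∧ ∃ l, 0 < (M.stayMatrix ^ l) t s := by
  obtain ⟨S, hS, hsS⟩ := hs
  have htS := ((M.stayMatrix_pos_iff_edge hS hsS).1 hst).2.1
  refine ⟨⟨S, hS, htS⟩, ?_⟩
  have hts := hS.1.2 t htS s hsS
  clear hst
  induction hts with
  | refl => exact ⟨0, by simp⟩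
  | tail _ h ih =>
    obtain ⟨l, hl⟩ := ih h.1
    exact ⟨l + 1, (pow_add_apply_pos_iff M.stayMatrix_mem_rowStochastic _ _ _ _).2
      ⟨_, hl, by simpa using (M.stayMatrix_pos_iff_edge hS h.1).2 h⟩⟩

variable (d₀ : stdSimplex ℝ Q)

theorem dist_freezing_succ {i : ℕ} (hi : 2 ^ Fintype.card Q ≤ i) :
    ⇑(M.dist d₀ M.freezingStrategy (i + 1)) =
      ⇑(M.dist d₀ M.freezingStrategy i) ᵥ* M.stayMatrix :=
  funext fun t => M.dist_succ_of_memoryless d₀ _ (ρ := M.stayDist)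
    (fun _ _ => if_neg (not_lt.2 hi)) t

/-- Each transition of the frozen chain is also possible under `σ_u`. -/
theorem mem_supp_uniform_of_stayMatrix_pow_pos [DecidableEq Q] {i l : ℕ} {s t : Q}
    (hs : s ∈ supp (M.dist d₀ (uniformStrategy Q A) i)) (hst : 0 < (M.stayMatrix ^ l) s t) :
    t ∈ supp (M.dist d₀ (uniformStrategy Q A) (i + l)) := by
  induction l generalizing t with
  | zero =>
    have : s = t := by
      by_contra hne
      simp [hne] at hst
    exact this ▸ hs
  | succ l ih =>
    obtain ⟨u, hu, hut⟩ :=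
      (pow_add_apply_pos_iff M.stayMatrix_mem_rowStochastic l 1 s t).1 hst
    rw [pow_one, stayMatrix_pos_iff] at hut
    obtain ⟨b, -, hb⟩ := hut
    rw [← add_assoc, M.supp_dist_succ_of_uniform d₀ (uniformStrategy Q A) fun _ _ => rfl]
    exact ⟨u, ih hu, b, hb⟩

/-- After freezing, the end-component states keep the support that they have under `σ_u`. -/
theorem mem_supp_freezing_of_mem_supp_uniform {q : Q} (hq : q ∈ M.endUnion) {r : ℕ}
    (h : q ∈ supp (M.dist d₀ (uniformStrategy Q A) (2 ^ Fintype.card Q + r))) :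
    q ∈ supp (M.dist d₀ M.freezingStrategy (2 ^ Fintype.card Q + r)) := by
  classical
  have hP := M.stayMatrix_mem_rowStochastic
  obtain ⟨p, hp, hper⟩ := M.exists_period_supp_uniform d₀
  obtain ⟨c, hc, hcyc⟩ : ∃ c > 0, 0 < (M.stayMatrix ^ c) q q := by
    obtain ⟨t, ht⟩ := exists_pow_apply_pos hP 1 q
    obtain ⟨-, l, hl⟩ := M.stayMatrix_recurrent hq (by simpa using ht)
    exact ⟨1 + l, by omega, (pow_add_apply_pos_iff hP _ _ _ _).2 ⟨t, ht, hl⟩⟩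
  -- A closed walk at `q` of length `p * (c * r)` is cut at the state `u` that lies `r` steps before
  -- its end. Following the first part, `σ_u` reaches `u` at step `2 ^ n + p * (c * r)`, hence by
  -- periodicity at step `2 ^ n`, where both strategies have the same support. The last `r` steps
  -- then bring the frozen chain to `q`.
  have hlen : r ≤ c * (p * r) := by
    rw [← mul_assoc]
    exact Nat.le_mul_of_pos_left r (Nat.mul_pos hc hp)
  have hwalk := pow_mul_apply_self_pos hP hcyc (p * r)
  obtain ⟨l, hl⟩ := Nat.exists_eq_add_of_le' hlen
  rw [hl] at hwalk
  obtain ⟨u, hqu, huq⟩ := (pow_add_apply_pos_iff hP _ _ _ _).1 hwalk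
  have hu := M.mem_supp_uniform_of_stayMatrix_pow_pos d₀ h hqu
  rw [show 2 ^ Fintype.card Q + r + l = 2 ^ Fintype.card Q + p * (c * r) by
    rw [add_assoc, add_comm r l, ← hl]; ring, hper _ le_rfl, ← M.supp_dist_freezing d₀ le_rfl] at hu
  have hiter : ∀ j, ⇑(M.dist d₀ M.freezingStrategy (2 ^ Fintype.card Q + j)) =
      ⇑(M.dist d₀ M.freezingStrategy (2 ^ Fintype.card Q)) ᵥ* M.stayMatrix ^ j := by
    intro j
    induction j with
    | zero => simp
    | succ j ih =>
      rw [← add_assoc, M.dist_freezing_succ d₀ (by omega), ih, pow_succ, Matrix.vecMul_vecMul]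
  change 0 < M.dist d₀ M.freezingStrategy (2 ^ Fintype.card Q + r) q
  rw [hiter]
  exact Finset.sum_pos' (fun s _ => mul_nonneg (stdSimplex.zero_le _ _) ((pow_mem hP r).1 s q))
    ⟨u, Finset.mem_univ u, mul_pos hu huq⟩

theorem exists_forall_lt_mass_freezing {T : Set Q} (h2 : M.Condition2 d₀ T) :
    ∃ ε > 0, ∀ i ≥ 2 ^ Fintype.card Q, ε < mass (M.dist d₀ M.freezingStrategy i) T := by
  classical
  have hP := M.stayMatrix_mem_rowStochastic
  obtain ⟨k, hk, hidem⟩ := exists_pow_mul_apply_pos_iff hP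
  have h : ∀ r : ℕ, ∃ c > 0, ∀ m,
      c ≤ mass (M.dist d₀ M.freezingStrategy (2 ^ Fintype.card Q + (r + k * m))) T := by
    intro r
    obtain ⟨q, ⟨hqE, hqT⟩, hq⟩ := mass_pos_iff.1 (h2 (2 ^ Fintype.card Q + r) (by omega))
    obtain ⟨c, hc, hle⟩ := exists_uniform_lower_bound hP
      (fun s hs t => M.stayMatrix_recurrent hs) hk hidem
      (D := fun i => ⇑(M.dist d₀ M.freezingStrategy (2 ^ Fintype.card Q + i)))
      (fun i s => stdSimplex.zero_le _ _) (fun i => M.dist_freezing_succ d₀ (Nat.le_add_right _ i)) hqE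
      (M.mem_supp_freezing_of_mem_supp_uniform d₀ hqE hq)
    exact ⟨c, hc, fun m => (hle m).trans (apply_le_mass _ hqT)⟩
  choose c hc hle using h
  -- Only the residues modulo `k` matter; halving `ε` makes the inequality strict.
  obtain ⟨ε, hε, hεc⟩ := exists_pos_lower_bound fun r : Fin k => c r
  refine ⟨ε / 2, half_pos hε, fun i hi => ?_⟩
  obtain ⟨j, rfl⟩ := Nat.exists_eq_add_of_le hi
  have h1 := hle (j % k) (j / k)
  rw [Nat.mod_add_div] at h1
  have h3 := hεc ⟨j % k, Nat.mod_lt j hk⟩ (hc _)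
  dsimp only at h3
  linarith

end Freezing

/-! ### The equivalences for the synchronizing modes. -/

section Synchronization

variable {Q A : Type*} [Fintype Q] [Fintype A] [Nonempty A] {M : MDP Q A} {d₀ : stdSimplex ℝ Q}
  {T : Set Q}

theorem BoundedlyAlways.positivelyAlways {d : ℕ → stdSimplex ℝ Q} (h : BoundedlyAlways d T) :
    PositivelyAlways d T :=
  let ⟨_, hε, h⟩ := h
  fun i => hε.trans (h i)

theorem BoundedlyAlways.boundedlyStrongly {d : ℕ → stdSimplex ℝ Q} (h : BoundedlyAlways d T) :
    BoundedlyStrongly d T :=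
  let ⟨ε, hε, h⟩ := h
  ⟨ε, hε, 0, fun i _ => h i⟩

theorem condition1_of_positivelyAlways {σ : Strategy Q A}
    (h : PositivelyAlways (M.dist d₀ σ) T) : M.Condition1 d₀ T := fun i =>
  let ⟨q, hqT, hq⟩ := mass_pos_iff.1 (h i)
  mass_pos_iff.2 ⟨q, hqT, M.supp_dist_subset_uniform d₀ σ i hq⟩

theorem condition2_of_boundedlyStrongly {σ : Strategy Q A}
    (h : BoundedlyStrongly (M.dist d₀ σ) T) : M.Condition2 d₀ T := by
  intro i hi
  obtain ⟨ε, hε, N, hN⟩ := h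
  obtain ⟨p, hp, hper⟩ := M.exists_period_supp_uniform d₀
  -- The shift by `p * N` passes the threshold `N` without changing the residue of `i` modulo the
  -- period.
  obtain ⟨m, hm⟩ := M.exists_mass_compl_endUnion_lt d₀ σ (i + p * N) hp hε
  have hlarge : N ≤ i + p * N + p * m := by nlinarith
  have h1 := mass_le_mass_inter_add_mass_compl (M.dist d₀ σ (i + p * N + p * m)) M.endUnion T
  have h2 := hN _ hlarge
  obtain ⟨q, hqT, hq⟩ := mass_pos_iff.1 (show 0 < mass (M.dist d₀ σ (i + p * N + p * m))
    (M.endUnion ∩ T) by linarith)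
  refine mass_pos_iff.2 ⟨q, hqT, ?_⟩
  have h3 := M.supp_dist_subset_uniform d₀ σ _ hq
  rw [add_assoc, ← mul_add, hper i hi] at h3
  exact h3

theorem Condition2.boundedlyStrongly_freezing (h2 : M.Condition2 d₀ T) :
    BoundedlyStrongly (M.dist d₀ M.freezingStrategy) T :=
  let ⟨ε, hε, h⟩ := M.exists_forall_lt_mass_freezing d₀ h2
  ⟨ε, hε, _, h⟩

theorem Condition2.boundedlyAlways_freezing (h1 : M.Condition1 d₀ T) (h2 : M.Condition2 d₀ T) :
    BoundedlyAlways (M.dist d₀ M.freezingStrategy) T := by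
  obtain ⟨ε, hε, h⟩ := M.exists_forall_lt_mass_freezing d₀ h2
  -- The finitely many steps before freezing have positive mass in `T` by (1).
  obtain ⟨c, hc, hle⟩ := exists_pos_lower_bound fun i : Fin (2 ^ Fintype.card Q) =>
    mass (M.dist d₀ M.freezingStrategy i) T
  refine ⟨min ε (c / 2), lt_min hε (half_pos hc), fun i => ?_⟩
  rcases lt_or_ge i (2 ^ Fintype.card Q) with hi | hi
  · obtain ⟨q, hqT, hq⟩ := mass_pos_iff.1 (h1 i)
    have hq' : q ∈ supp (M.dist d₀ M.freezingStrategy i) := by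
      rw [M.supp_dist_freezing d₀ hi.le]
      exact hq
    have h3 : c ≤ mass (M.dist d₀ M.freezingStrategy i) T :=
      hle ⟨i, hi⟩ (mass_pos_iff.2 ⟨q, hqT, hq'⟩)
    exact (min_le_right _ _).trans_lt (by linarith)
  · exact (min_le_left _ _).trans_lt (h i hi)

end Synchronization

end MDP

theorem mainTheorem4 {Q A : Type*} [Fintype Q] [Fintype A] [Nonempty A] (M : MDP Q A)
    (d₀ : stdSimplex ℝ Q) (T : Set Q) :
    (d₀ ∈ M.winPositiveAlways T ↔ M.Condition1 d₀ T) ∧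
    (d₀ ∈ M.winBoundedStrongly T ↔ M.Condition2 d₀ T) ∧
    (d₀ ∈ M.winBoundedAlways T ↔ M.Condition1 d₀ T ∧ M.Condition2 d₀ T) ∧
    (M.Condition2 d₀ T → MDP.BoundedlyStrongly (M.dist d₀ M.freezingStrategy) T) ∧
    (M.Condition1 d₀ T → M.Condition2 d₀ T →
      MDP.BoundedlyAlways (M.dist d₀ M.freezingStrategy) T) := by
  -- The witness is `σ_u` for the positive mode and the freezing strategy for both bounded modes.
  refine ⟨⟨fun ⟨_, h⟩ => MDP.condition1_of_positivelyAlways h, fun h => ⟨_, h⟩⟩,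
    ⟨fun ⟨_, h⟩ => MDP.condition2_of_boundedlyStrongly h,
      fun h => ⟨_, h.boundedlyStrongly_freezing⟩⟩,
    ⟨fun ⟨_, h⟩ => ⟨MDP.condition1_of_positivelyAlways h.positivelyAlways,
      MDP.condition2_of_boundedlyStrongly h.boundedlyStrongly⟩,
      fun h => ⟨_, h.2.boundedlyAlways_freezing h.1⟩⟩,
    fun h => h.boundedlyStrongly_freezing, fun h1 h2 => h2.boundedlyAlways_freezing h1⟩
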